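/- Let $\Gamma$ be a nonempty finite connected trivalent graph embedded in the oriented sphere $S^2$ (multiple edges and loops allowed). Let $\pi:\Lambda_\Gamma\to S^2$ be the associated surface: the double cover branched exactly at the vertices of $\Gamma$, whose two sheets over each face $F$ (an open disk) are labelled $F^+$ and $F^-$, with upper and lower sheet exchanged whenever one crosses an edge. For each face $F$ fix a point $p_F\in F$, let $p_F^\pm\in F^\pm$ be its two lifts, and let $\mathfrak p_\Gamma$ be the set of all the points $p_F^+$ and $p_F^-$. For each edge $E$ of $\Gamma$ let $\widetilde E=\pi^{-1}(E)$, a closed curve on $\Lambda_\Gamma\setminus\mathfrak p_\Gamma$ passing straight through the branch points (it is simple if $E$ is not a loop, and in general immersed). A spin structure on an oriented surface $S$ is a class in $H^1(UTS;\mathbb Z/2)$, where $UTS$ is the unit tangent bundle, which takes the value $1$ on the fibre; this is the same as an isomorphism class of double covers of $UTS$ nontrivial on the fibres. It restricts to the Lie group spin structure on an immersed closed curve $C$ if it takes the value $0$ on the loop of unit tangent vectors of $C$ (and to the bounding spin structure if the value is $1$, as for the boundary of a disk). A $\mathfrak p_\Gamma$-twisted spin structure on $\Lambda_\Gamma$ is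 a spin structure on $\Lambda_\Gamma\setminus\mathfrak p_\Gamma$ which restricts to the Lie group spin structure on a small loop around each point of $\mathfrak p_\Gamma$. Then there is a unique (up to isomorphism) $\mathfrak p_\Gamma$-twisted spin structure on $\Lambda_\Gamma$ whose restriction to $\widetilde E$ is the Lie group spin structure for every edge $E$ of $\Gamma$. -/

import Mathlib

open Finset

/-- A graph cellularly embedded in a closed oriented surface, presented by its half-edges
("darts"): `rev` sends a half-edge to the other half of its edge, and `rot` sends a half-edge to the
next one counterclockwise around its vertex.  A dart is also regarded as an oriented edge, leaving
its vertex. The vertices are the orbits of `rot` and the edges the orbits of `rev`;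
loops and multiple edges are allowed.  The surface is obtained by gluing a disk along each orbit of
`face` below, so each face is an open disk. -/
structure CombinatorialMap (D : Type*) where
  rev : Equiv.Perm D
  rot : Equiv.Perm D
  rev_rev : ∀ d, rev (rev d) = d
  rev_ne : ∀ d, rev d ≠ d

namespace CombinatorialMap

variable {D : Type*}

/-- The next oriented edge along the boundary of the face lying to the left of `d`. -/
def face (M : CombinatorialMap D) : Equiv.Perm D := M.rev.trans M.rot.symm

/-- The number of half-edges at the vertex of `d`. -/
noncomputable def valency (M : CombinatorialMap D) (d : D) : ℕ := Function.minimalPeriod M.rot d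

/-- Every vertex has exactly three half-edges. -/
def IsTrivalent (M : CombinatorialMap D) : Prop := ∀ d, M.valency d = 3

/-- The graph (equivalently, the surface) is connected. -/
def IsConnected (M : CombinatorialMap D) : Prop :=
  MulAction.IsPretransitive (Subgroup.closure {M.rev, M.rot} : Subgroup (Equiv.Perm D)) D

/-- A cellular 1-chain mod 2: a set of (unoriented) edges. -/
def IsOneChain (M : CombinatorialMap D) (c : D → ZMod 2) : Prop := ∀ d, c (M.rev d) = c d

/-- The boundary of the chain `c` vanishes: at each vertex, the coefficients of the half-edges
there sum to zero. -/
def IsOneCycle (M : CombinatorialMap D) (c : D → ZMod 2) : Prop :=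
  M.IsOneChain c ∧ ∀ d, ∑ i ∈ range (M.valency d), c (M.rot^[i] d) = 0

/-- A cellular 2-chain mod 2: a set of faces, as a function of a dart through the face on its
left. -/
def IsTwoChain (M : CombinatorialMap D) (b : D → ZMod 2) : Prop := ∀ d, b (M.face d) = b d

/-- The underlying closed oriented surface is the sphere: it is connected and its first homology
mod 2 vanishes, i.e. every cycle is the boundary of a set of faces. (By the classification of
surfaces the sphere is the only such closed connected surface.) -/
def IsSphere (M : CombinatorialMap D) : Prop :=
  M.IsConnected ∧ ∀ c, M.IsOneCycle c →
    ∃ b, M.IsTwoChain b ∧ ∀ d, c d = b d + b (M.rev d)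

/-- A closed immersed curve running along the graph: it follows the oriented edges `dart 0`,
`dart 1`, …, `dart (length - 1)`.  Having arrived by `dart i` at the vertex of the half-edge
`rev (dart i)`, it leaves along the half-edge `turn i` places counterclockwise from that one.  Its
velocity rotates there by the angle `-π + turn i · (2π/n)`, where `n` is the valency, the half-edges
being equally spaced.  (So `turn i = n/2` is going straight on, and `0 < turn i < n` are the turns
of angle strictly between `-π` and `π`.) -/
structure ClosedCurve (M : CombinatorialMap D) where
  length : ℕ
  dart : ℕ → D
  turn : ℕ → ℕ
  dart_succ : ∀ i < length, dart (i + 1) = M.rot^[turn i] (M.rev (dart i))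
  dart_length : dart length = dart 0

/-- The curve running around the face to the left of `d`, parallel to its boundary and with the
face on its left, turning at each corner to the next half-edge clockwise from the one by which it
arrived.  In the surface with a point removed from each face, it is isotopic (as an immersed curve)
to the boundary of a small disk around the point removed from that face. -/
noncomputable def faceCurve [Finite D] (M : CombinatorialMap D) (d : D) : M.ClosedCurve where
  length := Function.minimalPeriod M.face d
  dart i := M.face^[i] d
  turn i := M.valency (M.rev (M.face^[i] d)) - 1
  dart_succ i _ := by
    rw [Function.iterate_succ_apply']
    set a := M.rev (M.face^[i] d) with ha
    have hpos : 0 < M.valency a :=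
      Function.minimalPeriod_pos_of_mem_periodicPts
        (M.rot.injective.mem_periodicPts a)
    have h : M.rot (M.rot^[M.valency a - 1] a) = a := by
      rw [← Function.iterate_succ_apply' M.rot, Nat.succ_eq_add_one, Nat.sub_add_cancel hpos]
      exact Function.iterate_minimalPeriod
    show M.rot.symm a = _
    rw [Equiv.symm_apply_eq, h]
  dart_length := Function.iterate_minimalPeriod

/-!
Spin structures.  Let `S` be the surface of `M` with one point removed from each face; it
deformation retracts onto a ribbon neighbourhood of the graph.  A spin structure on `S` is a double
cover of its unit tangent bundle `UT S` which is nontrivial over each circle fibre; up to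
isomorphism, it is a class in `H¹(UT S; ℤ/2)` taking the value `1` on the fibre.

The classes in `H¹(UT S; ℤ/2)` are computed by the following complex. Its 0-cells are the darts `d`
(the unit vector at the vertex of `d` pointing along `d`).  It has two kinds of 1-cells:
* from `d` to `rot d`, rotating the vector counterclockwise to the next half-edge;
* from `d` to `rev d`, transporting the vector along the oriented edge `d`, tangentially to it, and
  then rotating it clockwise by `π`.
Following the second for `d` and then for `rev d` gives a loop homotopic to one full clockwise turn
in the fibre, and these are the only relations, besides that all fibres are homotopic.
-/

/-- A spin structure on the surface of `M` with a point removed from each face, as a 1-cocycle on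
the complex above: `onRot` and `onEdge` are its values on the two kinds of 1-cells, the
value on each fibre is `1`, and then the remaining cocycle condition says that
`onEdge d + onEdge (rev d) = 1`. -/
structure SpinCocycle (M : CombinatorialMap D) where
  onRot : D → ZMod 2
  onEdge : D → ZMod 2
  fibre : ∀ d, ∑ i ∈ range (M.valency d), onRot (M.rot^[i] d) = 1
  edge : ∀ d, onEdge d + onEdge (M.rev d) = 1

/-- Isomorphism of spin structures: the cocycles differ by the coboundary of a 0-cochain. -/
def SpinCocycle.Iso {M : CombinatorialMap D} (s s' : M.SpinCocycle) : Prop :=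
  ∃ f : D → ZMod 2, (∀ d, s'.onRot d = s.onRot d + (f d + f (M.rot d))) ∧
    ∀ d, s'.onEdge d = s.onEdge d + (f d + f (M.rev d))

instance SpinCocycle.setoid (M : CombinatorialMap D) : Setoid M.SpinCocycle where
  r := SpinCocycle.Iso
  iseqv :=
    { refl := fun s => ⟨fun _ => 0, by simp, by simp⟩
      symm := by
        rintro s s' ⟨f, h1, h2⟩
        refine ⟨f, fun d => ?_, fun d => ?_⟩
        · rw [h1, add_assoc, CharTwo.add_self_eq_zero, add_zero]
        · rw [h2, add_assoc, CharTwo.add_self_eq_zero, add_zero]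
      trans := by
        rintro s s' s'' ⟨f, h1, h2⟩ ⟨g, h3, h4⟩
        refine ⟨f + g, fun d => ?_, fun d => ?_⟩
        · rw [h3, h1]; simp only [Pi.add_apply]; ring
        · rw [h4, h2]; simp only [Pi.add_apply]; ring }

/-- The value of the cocycle on the loop in `UT S` formed by the unit tangent vectors of a closed
immersed curve. -/
def SpinCocycle.onCurve {M : CombinatorialMap D} (s : M.SpinCocycle) (γ : M.ClosedCurve) : ZMod 2 :=
  ∑ i ∈ range γ.length, (s.onEdge (γ.dart i) +
    ∑ j ∈ range (γ.turn i), s.onRot (M.rot^[j] (M.rev (γ.dart i))))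

theorem sum_range_add_succ (f : ℕ → ZMod 2) (n : ℕ) :
    ∑ j ∈ range n, (f j + f (j + 1)) = f 0 + f n := by
  induction n with
  | zero => simp [CharTwo.add_self_eq_zero]
  | succ k ih =>
    rw [sum_range_succ, ih, add_assoc, ← add_assoc (f k), CharTwo.add_self_eq_zero, zero_add]

theorem SpinCocycle.Iso.onCurve_eq {M : CombinatorialMap D} {s s' : M.SpinCocycle}
    (h : s.Iso s') (γ : M.ClosedCurve) : s.onCurve γ = s'.onCurve γ := by
  obtain ⟨f, h1, h2⟩ := h
  have key : ∀ i ∈ range γ.length, (s'.onEdge (γ.dart i) +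
      ∑ j ∈ range (γ.turn i), s'.onRot (M.rot^[j] (M.rev (γ.dart i)))) =
      (s.onEdge (γ.dart i) + ∑ j ∈ range (γ.turn i), s.onRot (M.rot^[j] (M.rev (γ.dart i)))) +
        (f (γ.dart i) + f (γ.dart (i + 1))) := by
    intro i hi
    rw [γ.dart_succ i (mem_range.1 hi)]
    simp only [h1, h2, sum_add_distrib, ← Function.iterate_succ_apply' M.rot]
    rw [← sum_add_distrib (f := fun j => f (M.rot^[j] (M.rev (γ.dart i)))),
      sum_range_add_succ (fun j => f (M.rot^[j] (M.rev (γ.dart i))))]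
    simp only [Function.iterate_zero, id]
    linear_combination f (M.rev (γ.dart i)) * (CharTwo.two_eq_zero : (2 : ZMod 2) = 0)
  unfold SpinCocycle.onCurve
  rw [sum_congr rfl key, sum_add_distrib (g := fun i => f (γ.dart i) + f (γ.dart (i + 1))),
    sum_range_add_succ (fun i => f (γ.dart i)), γ.dart_length, CharTwo.add_self_eq_zero, add_zero]

/-- Isomorphism classes of spin structures on the surface of `M` with a point removed from each
face. -/
def SpinStructure (M : CombinatorialMap D) : Type _ := Quotient (SpinCocycle.setoid M)

/-- The value on the loop of unit tangent vectors of a closed curve. -/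
def SpinStructure.onCurve {M : CombinatorialMap D} (s : M.SpinStructure) (γ : M.ClosedCurve) :
    ZMod 2 :=
  Quotient.lift (fun c : M.SpinCocycle => c.onCurve γ) (fun _ _ h => SpinCocycle.Iso.onCurve_eq h γ)
    s

/-- The spin structure restricts to the Lie group spin structure on the curve: the double cover is
trivial over the loop of its unit tangent vectors.  (On the boundary of a disk that loop is homotopic
to a fibre, and the value is `1`: the bounding spin structure.) -/
def SpinStructure.IsLieGroupOn {M : CombinatorialMap D} (s : M.SpinStructure)
    (γ : M.ClosedCurve) : Prop := s.onCurve γ = 0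

/-- The surface `Λ`, double cover of the surface of the trivalent graph `M`, branched exactly at the
vertices, with the preimage of the graph.  Over each face `F` lie the sheets `F⁺` (`true`) and
`F⁻` (`false`), and crossing an edge exchanges upper and lower.  The half-edge `(d, ε)` is the lift
of `d` which has on its left the sheet `ε` of the face to the left of `d`; it then has on its right
the sheet `!ε` of the face to the right of `d`.  The vertices of `Λ` have valency six, and the
deck transformation `(d, ε) ↦ (d, !ε)` is a half turn around each of them. -/
def branchedDoubleCover (M : CombinatorialMap D) : CombinatorialMap (D × Bool) where
  rev := Equiv.prodCongr M.rev Equiv.boolNot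
  rot := Equiv.prodCongr M.rot Equiv.boolNot
  rev_rev := by rintro ⟨d, ε⟩; simp [M.rev_rev]
  rev_ne := by rintro ⟨d, ε⟩ h; exact M.rev_ne d (congrArg Prod.fst h)

/-- The preimage `Ẽ` in `Λ` of the edge `E = {d, rev d}`: it follows one lift of `E`, passes straight
through the branch point (`3` places out of six), and returns along the other lift.  It is oriented
with upper sheets on its left.  (It is simple unless `E` is a loop.) -/
def edgeCurve (M : CombinatorialMap D) (hM : M.IsTrivalent) (d : D) :
    M.branchedDoubleCover.ClosedCurve where
  length := 2
  dart i := (M.rev^[i] d, true)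
  turn _ := 3
  dart_succ i _ := by
    have h : M.rot^[3] (M.rev (M.rev^[i] d)) = M.rev (M.rev^[i] d) := by
      have := Function.iterate_minimalPeriod (f := M.rot) (x := M.rev (M.rev^[i] d))
      rwa [show Function.minimalPeriod M.rot (M.rev (M.rev^[i] d)) = 3 from hM _] at this
    rw [Function.iterate_succ_apply']
    exact Prod.ext h.symm rfl
  dart_length := by simp [M.rev_rev]

/-- Let `𝔭` be the set of points of `Λ` consisting of one point in each sheet `F⁺`, `F⁻` over
each face `F`.  A `𝔭`-twisted spin structure on `Λ` is a spin structure on `Λ` minus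
`𝔭` which restricts to the Lie group spin structure on the small loop around each point of `𝔭`. -/
def TwistedSpinStructure [Finite D] (M : CombinatorialMap D) : Type _ :=
  {s : M.branchedDoubleCover.SpinStructure //
    ∀ x : D × Bool, s.IsLieGroupOn (M.branchedDoubleCover.faceCurve x)}

end CombinatorialMap

namespace CombinatorialMap

/-! ### Sums along the orbits of a permutation -/

/-! Existence is an explicit cocycle, `invariantCocycle`. For uniqueness, the difference of two
solutions is a pair `(r, e)` of values on rotations and edges which vanishes on fibres, face curves
and edge curves; it must be a coboundary. Vanishing on fibres makes `r` the coboundary of some `F`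
at each branch point, and subtracting the coboundary of `F` leaves a function on the lifted edges
alone. The curve over an edge runs once along each of its two lifts, so its condition says that the
two lifts carry the same value: the remainder descends to a 1-cochain `E` on the sphere. The loops
in the upper sheets make `E` a cocycle, hence `E` is the coboundary of some `g` because the sphere
has no first cohomology (`IsSphere.exists_coboundary`), and `F + g` is the required primitive. -/

theorem sum_range_minimalPeriod_succ {α : Type*} (σ : Equiv.Perm α) (φ : α → ZMod 2) (x : α) :
    ∑ i ∈ range (Function.minimalPeriod σ x), φ (σ (σ^[i] x)) =
      ∑ i ∈ range (Function.minimalPeriod σ x), φ (σ^[i] x) := by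
  have h := sum_range_succ (fun i => φ (σ^[i] x)) (Function.minimalPeriod σ x)
  rw [sum_range_succ', Function.iterate_minimalPeriod] at h
  simp only [Function.iterate_zero, id] at h
  simpa only [Function.iterate_succ_apply'] using add_right_cancel h

/-- A function whose sum over each orbit of `σ` vanishes is orthogonal to the `σ`-invariant
functions. -/
theorem sum_mul_eq_zero_of_orbit_sums {α : Type*} [Fintype α] (σ : Equiv.Perm α)
    {φ b : α → ZMod 2} (hb : ∀ x, b (σ x) = b x)
    (hφ : ∀ x, ∑ i ∈ range (Function.minimalPeriod σ x), φ (σ^[i] x) = 0) :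
    ∑ x, φ x * b x = 0 := by
  classical
  have hbi : ∀ (i : ℕ) x, b (σ^[i] x) = b x := by
    intro i x
    induction i with
    | zero => rfl
    | succ k ih => rw [Function.iterate_succ_apply', hb, ih]
  rw [Finset.sum_partition (Equiv.Perm.SameCycle.setoid σ)]
  refine Finset.sum_eq_zero fun q _ => ?_
  induction q using Quotient.inductionOn with | _ x
  have himg : ({y ∈ (univ : Finset α) | Quotient.mk (Equiv.Perm.SameCycle.setoid σ) y =
      Quotient.mk (Equiv.Perm.SameCycle.setoid σ) x}) =
      (range (Function.minimalPeriod σ x)).image fun i => σ^[i] x := by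
    ext y
    simp only [mem_filter, mem_univ, true_and, mem_image, mem_range]
    rw [Quotient.eq]
    constructor
    · intro h
      obtain ⟨i, -, hi⟩ := (Equiv.Perm.SameCycle.symm h).exists_pow_eq'
      refine ⟨i % Function.minimalPeriod σ x, Nat.mod_lt _
        (Function.minimalPeriod_pos_of_mem_periodicPts (σ.injective.mem_periodicPts x)), ?_⟩
      rw [Function.iterate_mod_minimalPeriod_eq, ← hi, Equiv.Perm.coe_pow]
    · rintro ⟨i, -, rfl⟩
      rw [← Equiv.Perm.coe_pow]
      exact Equiv.Perm.SameCycle.symm ⟨i, by simp⟩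
  rw [himg, sum_image]
  · simp only [hbi, ← sum_mul, hφ, zero_mul]
  · intro i hi j hj h
    exact Function.iterate_injOn_Iio_minimalPeriod (by simpa using hi) (by simpa using hj) h

variable {D : Type*}

theorem rot_rot_rot {M : CombinatorialMap D} (hM : M.IsTrivalent) (d : D) :
    M.rot (M.rot (M.rot d)) = d := by
  have h := Function.iterate_minimalPeriod (f := M.rot) (x := d)
  rwa [show Function.minimalPeriod M.rot d = 3 from hM d] at h

/-! ### First cohomology of the sphere -/

/-- On the sphere, a cellular 1-cocycle mod 2 is a coboundary. -/
theorem IsSphere.exists_coboundary [Finite D] {M : CombinatorialMap D} (hS : M.IsSphere)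
    (hM : M.IsTrivalent) {E : D → ZMod 2} (hsymm : ∀ d, E (M.rev d) = E d)
    (hface : ∀ d, ∑ i ∈ range (Function.minimalPeriod M.face d), E (M.face^[i] d) = 0) :
    ∃ g : D → ZMod 2, (∀ d, g (M.rot d) = g d) ∧ ∀ d, E d = g d + g (M.rev d) := by
  classical
  cases nonempty_fintype D
  let N : (D → ZMod 2) →ₗ[ZMod 2] (D → ZMod 2) :=
    LinearMap.id + LinearMap.funLeft _ _ M.rot + LinearMap.funLeft _ _ (fun d => M.rot (M.rot d))
  -- `A` symmetrizes under `rev` and then sums around each vertex, so it is the boundary of the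
  -- 1-chain `x + x ∘ rev`. The homological hypothesis is dualized: pairing with `E` kills `ker A`,
  -- hence factors through `A`.
  let A : (D → ZMod 2) →ₗ[ZMod 2] (D → ZMod 2) := N ∘ₗ (LinearMap.id + LinearMap.funLeft _ _ M.rev)
  have hA : ∀ x d, A x d = (x d + x (M.rev d)) + (x (M.rot d) + x (M.rev (M.rot d))) +
      (x (M.rot (M.rot d)) + x (M.rev (M.rot (M.rot d)))) := fun x d => rfl
  let φ : Module.Dual (ZMod 2) (D → ZMod 2) := ∑ d, E d • LinearMap.proj d
  have hφ : ∀ x, φ x = ∑ d, E d * x d := fun x => by simp [φ]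
  have hker : φ ∈ (LinearMap.ker A).dualAnnihilator := by
    rw [Submodule.mem_dualAnnihilator]
    intro x hx
    obtain ⟨b, hb, hxb⟩ := hS.2 (fun d => x d + x (M.rev d)) ⟨fun d => by
        simp only [M.rev_rev, add_comm], fun d => by
        have h := congrFun (LinearMap.mem_ker.1 hx) d
        rw [hA] at h
        rw [hM d]
        simpa [sum_range_succ] using h⟩
    -- Both `E` and `x + b` are `rev`-invariant, so the terms cancel in pairs mod 2. The sum of `E *
    -- b` vanishes face by face.
    have h1 : ∑ d, E d * (x d + b d) = 0 := by
      refine Finset.sum_involution (fun d _ => M.rev d) (fun d _ => ?_) (fun d _ _ => M.rev_ne d)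
        (fun _ _ => mem_univ _) (fun d _ => M.rev_rev d)
      rw [hsymm, ← mul_add]
      linear_combination E d * hxb d + E d * (b d + b (M.rev d)) *
        (CharTwo.two_eq_zero : (2 : ZMod 2) = 0)
    have h2 := sum_mul_eq_zero_of_orbit_sums M.face hb hface
    simp only [mul_add, sum_add_distrib, h2, add_zero] at h1
    rw [hφ, h1]
  rw [← LinearMap.range_dualMap_eq_dualAnnihilator_ker] at hker
  obtain ⟨ψ, hψ⟩ := hker
  -- `N` sends the indicator of a dart to that of its vertex, so `g` is constant at vertices;
  -- evaluating `φ = ψ ∘ A` at the indicator of `d` gives `E d`.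
  let g : D → ZMod 2 := fun d => ψ (N (Pi.single d 1))
  have hsingle : ∀ (σ : Equiv.Perm D) d, LinearMap.funLeft (ZMod 2) (ZMod 2) σ
      (Pi.single (σ d) 1) = Pi.single d 1 := by
    intro σ d
    ext x
    simp [LinearMap.funLeft_apply, Pi.single_apply]
  refine ⟨g, fun d => ?_, fun d => ?_⟩
  · have h : N (Pi.single (M.rot d) 1) = N (Pi.single d 1) := by
      ext x
      have h3 := rot_rot_rot hM
      have e1 : M.rot (M.rot x) = M.rot d ↔ M.rot x = d := M.rot.apply_eq_iff_eq
      have e2 : M.rot x = M.rot d ↔ x = d := M.rot.apply_eq_iff_eq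
      have e3 : x = M.rot d ↔ M.rot (M.rot x) = d :=
        ⟨fun h => by rw [h, h3], fun h => by rw [← h, h3]⟩
      simp only [N, LinearMap.add_apply, LinearMap.id_apply, LinearMap.funLeft_apply, Pi.add_apply,
        Pi.single_apply, e1, e2, e3]
      ring
    simp only [g, h]
  · have h := LinearMap.congr_fun hψ (Pi.single d 1)
    rw [hφ] at h
    simp only [Pi.single_apply, mul_ite, mul_one, mul_zero, sum_ite_eq', mem_univ, if_true] at h
    rw [← h]
    have h' := hsingle M.rev (M.rev d)
    rw [M.rev_rev] at h'
    simp only [LinearMap.dualMap_apply, A, LinearMap.comp_apply, LinearMap.add_apply, h',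
      LinearMap.id_apply, map_add, g]

/-! ### Spin structures along face curves -/

/-- Turning `valency - 1` places counterclockwise is a full fibre, of value 1, less the last
rotation, which starts at the next dart of the face. A cyclic shift moves that term back to the
current dart. -/
theorem SpinCocycle.onCurve_faceCurve [Finite D] {M : CombinatorialMap D} (s : M.SpinCocycle)
    (d : D) : s.onCurve (M.faceCurve d) = ∑ i ∈ range (Function.minimalPeriod M.face d),
      (s.onEdge (M.face^[i] d) + s.onRot (M.face^[i] d) + 1) := by
  have key : ∀ a, ∑ j ∈ range (M.valency a - 1), s.onRot (M.rot^[j] a) =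
      s.onRot (M.rot.symm a) + 1 := by
    intro a
    have hpos : 0 < M.valency a := Function.minimalPeriod_pos_of_mem_periodicPts
      (M.rot.injective.mem_periodicPts a)
    have h := s.fibre a
    have hlast : M.rot^[M.valency a - 1] a = M.rot.symm a := by
      rw [Equiv.eq_symm_apply, ← Function.iterate_succ_apply' M.rot, Nat.succ_eq_add_one,
        Nat.sub_add_cancel hpos]
      exact Function.iterate_minimalPeriod
    rw [show M.valency a = M.valency a - 1 + 1 by omega, sum_range_succ, hlast] at h
    rw [← h]
    linear_combination -s.onRot (M.rot.symm a) * (CharTwo.two_eq_zero : (2 : ZMod 2) = 0)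
  have h := sum_range_minimalPeriod_succ M.face s.onRot d
  simp only [SpinCocycle.onCurve, faceCurve, key]
  simp only [sum_add_distrib] at h ⊢
  rw [← h, add_assoc]
  rfl

/-! ### The branched double cover -/

theorem branchedDoubleCover_rot (M : CombinatorialMap D) (d : D) (ε : Bool) :
    M.branchedDoubleCover.rot (d, ε) = (M.rot d, !ε) := rfl

theorem branchedDoubleCover_rev (M : CombinatorialMap D) (d : D) (ε : Bool) :
    M.branchedDoubleCover.rev (d, ε) = (M.rev d, !ε) := rfl

theorem branchedDoubleCover_face (M : CombinatorialMap D) (d : D) (ε : Bool) :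
    M.branchedDoubleCover.face (d, ε) = (M.face d, ε) := by
  show M.branchedDoubleCover.rot.symm (M.rev d, !ε) = (M.rot.symm (M.rev d), ε)
  rw [Equiv.symm_apply_eq, branchedDoubleCover_rot, Equiv.apply_symm_apply]

theorem branchedDoubleCover_face_iterate (M : CombinatorialMap D) (i : ℕ) (d : D) (ε : Bool) :
    M.branchedDoubleCover.face^[i] (d, ε) = (M.face^[i] d, ε) := by
  induction i with
  | zero => rfl
  | succ k ih => simp only [Function.iterate_succ_apply', ih, branchedDoubleCover_face]

theorem branchedDoubleCover_minimalPeriod_face (M : CombinatorialMap D) (d : D) (ε : Bool) :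
    Function.minimalPeriod M.branchedDoubleCover.face (d, ε) =
      Function.minimalPeriod M.face d := by
  apply Function.minimalPeriod_eq_minimalPeriod_iff.2
  intro n
  simp [Function.IsPeriodicPt, Function.IsFixedPt, branchedDoubleCover_face_iterate]

theorem branchedDoubleCover_rot_iterate (M : CombinatorialMap D) (i : ℕ) (d : D) (ε : Bool) :
    M.branchedDoubleCover.rot^[i] (d, ε) = (M.rot^[i] d, Bool.not^[i] ε) := by
  induction i with
  | zero => rfl
  | succ k ih => simp only [Function.iterate_succ_apply', ih, branchedDoubleCover_rot]

theorem branchedDoubleCover_valency {M : CombinatorialMap D} (hM : M.IsTrivalent) (x : D × Bool) :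
    M.branchedDoubleCover.valency x = 6 := by
  obtain ⟨d, ε⟩ := x
  have hd : Function.minimalPeriod M.rot d = 3 := hM d
  have hε : Function.minimalPeriod Bool.not ε = 2 :=
    Function.minimalPeriod_eq_prime (p := 2) (by
      cases ε <;> rfl) (by cases ε <;> simp [Function.IsFixedPt])
  have h : ∀ n, M.branchedDoubleCover.rot^[n] (d, ε) = (d, ε) ↔ 6 ∣ n := by
    intro n
    have h1 : M.rot^[n] d = d ↔ 3 ∣ n := by
      rw [← hd]; exact Function.isPeriodicPt_iff_minimalPeriod_dvd
    have h2 : Bool.not^[n] ε = ε ↔ 2 ∣ n := by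
      rw [← hε]; exact Function.isPeriodicPt_iff_minimalPeriod_dvd
    rw [branchedDoubleCover_rot_iterate, Prod.mk.injEq, h1, h2]
    omega
  refine Nat.dvd_antisymm ?_ ?_
  · exact Function.isPeriodicPt_iff_minimalPeriod_dvd.1 ((h 6).2 dvd_rfl)
  · exact (h _).1 Function.iterate_minimalPeriod

/-- The fibre condition over the branch points. -/
theorem fibre_branchedDoubleCover {M : CombinatorialMap D} (hM : M.IsTrivalent)
    (s : M.branchedDoubleCover.SpinCocycle) (d : D) (ε : Bool) :
    s.onRot (d, ε) + s.onRot (M.rot d, !ε) + s.onRot (M.rot (M.rot d), ε) +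
      s.onRot (d, !ε) + s.onRot (M.rot d, ε) + s.onRot (M.rot (M.rot d), !ε) = 1 := by
  have h := s.fibre (d, ε)
  rw [branchedDoubleCover_valency hM] at h
  simpa [sum_range_succ, branchedDoubleCover_rot, rot_rot_rot hM] using h

theorem onCurve_faceCurve_branchedDoubleCover [Finite D] {M : CombinatorialMap D}
    (s : M.branchedDoubleCover.SpinCocycle) (d : D) (ε : Bool) :
    s.onCurve (M.branchedDoubleCover.faceCurve (d, ε)) =
      ∑ i ∈ range (Function.minimalPeriod M.face d),
        (s.onEdge (M.face^[i] d, ε) + s.onRot (M.face^[i] d, ε) + 1) := by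
  simp only [SpinCocycle.onCurve_faceCurve, branchedDoubleCover_minimalPeriod_face,
    branchedDoubleCover_face_iterate]

theorem onCurve_edgeCurve {M : CombinatorialMap D} (hM : M.IsTrivalent)
    (s : M.branchedDoubleCover.SpinCocycle) (d : D) :
    s.onCurve (M.edgeCurve hM d) =
      s.onEdge (d, true) + s.onEdge (M.rev d, true) +
      (s.onRot (M.rev d, false) + s.onRot (M.rot (M.rev d), true) +
        s.onRot (M.rot (M.rot (M.rev d)), false)) +
      (s.onRot (d, false) + s.onRot (M.rot d, true) + s.onRot (M.rot (M.rot d), false)) := by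
  simp only [SpinCocycle.onCurve, edgeCurve, sum_range_succ, sum_range_zero, zero_add,
    Function.iterate_zero, Function.iterate_succ, Function.comp_apply, id,
    branchedDoubleCover_rot, branchedDoubleCover_rev, M.rev_rev, Bool.not_true, Bool.not_false]
  ring

/-! ### Existence: the invariant cocycle -/

/-- The cocycle which is invariant under all orientation preserving symmetries. -/
def invariantCocycle (M : CombinatorialMap D) (hM : M.IsTrivalent) :
    M.branchedDoubleCover.SpinCocycle where
  onRot x := if x.2 then 1 else 0
  onEdge x := if x.2 then 0 else 1
  fibre := by
    rintro ⟨d, ε⟩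
    rw [branchedDoubleCover_valency hM]
    -- The sheets alternate around a branch point, so three of the six rotations have value 1: an
    -- odd number.
    cases ε <;> simp only [branchedDoubleCover_rot_iterate, sum_range_succ, sum_range_zero] <;>
      decide
  edge := by
    rintro ⟨d, ε⟩
    cases ε <;> simp [branchedDoubleCover_rev]

theorem invariantCocycle_faceCurve [Finite D] (M : CombinatorialMap D) (hM : M.IsTrivalent)
    (x : D × Bool) :
    (M.invariantCocycle hM).onCurve (M.branchedDoubleCover.faceCurve x) = 0 := by
  obtain ⟨d, ε⟩ := x
  rw [onCurve_faceCurve_branchedDoubleCover]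
  refine sum_eq_zero fun i _ => ?_
  cases ε <;> simp [invariantCocycle, CharTwo.add_self_eq_zero]

theorem invariantCocycle_edgeCurve (M : CombinatorialMap D) (hM : M.IsTrivalent) (d : D) :
    (M.invariantCocycle hM).onCurve (M.edgeCurve hM d) = 0 := by
  rw [onCurve_edgeCurve]
  simp [invariantCocycle, CharTwo.add_self_eq_zero]

/-! ### Uniqueness: descent of the difference to the sphere -/

/-- A 1-cocycle on the unit tangent bundle of the punctured double cover which vanishes on the
fibres, on the face curves and on the preimages of the edges is a coboundary. -/
theorem IsSphere.exists_coboundary_branchedDoubleCover [Finite D] {M : CombinatorialMap D}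
    (hS : M.IsSphere) (hM : M.IsTrivalent) {r e : D → Bool → ZMod 2}
    (hfibre : ∀ d, r d true + r (M.rot d) false + r (M.rot (M.rot d)) true +
      r d false + r (M.rot d) true + r (M.rot (M.rot d)) false = 0)
    (hedge : ∀ d ε, e d ε = e (M.rev d) (!ε))
    (hface : ∀ d, ∑ i ∈ range (Function.minimalPeriod M.face d),
      (e (M.face^[i] d) true + r (M.face^[i] d) true) = 0)
    (hcurve : ∀ d, e d true + e (M.rev d) true +
      (r (M.rev d) false + r (M.rot (M.rev d)) true + r (M.rot (M.rot (M.rev d))) false) +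
      (r d false + r (M.rot d) true + r (M.rot (M.rot d)) false) = 0) :
    ∃ f : D → Bool → ZMod 2, (∀ d ε, r d ε = f d ε + f (M.rot d) (!ε)) ∧
      ∀ d ε, e d ε = f d ε + f (M.rev d) (!ε) := by
  have two : (2 : ZMod 2) = 0 := CharTwo.two_eq_zero
  have h3 := rot_rot_rot hM
  -- `h` is the value on a half turn, and `k` normalizes the values on rotations.
  let h : D → ZMod 2 := fun d => r d true + r (M.rot d) false + r (M.rot (M.rot d)) true
  let k : D → ZMod 2 := fun d => r (M.rot d) false + h (M.rot (M.rot d))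
  let F : D → Bool → ZMod 2 := fun d ε => (if ε then h d else 0) + k d
  -- Three rotations lead from `(d, true)` to `(d, false)`, which forces a primitive to jump by `h
  -- d` between them. The remaining constant at each vertex is fixed by making `k` sum to 0 over its
  -- three darts.
  have hF : ∀ d ε, r d ε = F d ε + F (M.rot d) (!ε) := by
    intro d ε
    cases ε
    · simp only [F, k, h, h3, Bool.not_false, if_true, Bool.false_eq_true, if_false]
      have hd := hfibre d
      clear two
      grind
    · simp only [F, k, h, h3, Bool.not_true, if_true, Bool.false_eq_true, if_false]
      have hd := hfibre d
      clear two
      grind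
  let E : D → ZMod 2 := fun d => e d true + F d true + F (M.rev d) false
  -- The two sides differ by `e d true + e d false + h d + h (M.rev d)`. This is the value on the
  -- edge curve, as the two complementary half turns at a vertex agree by `hfibre`.
  have hE : ∀ d, E d = e d false + F d false + F (M.rev d) true := by
    intro d
    have h1 := hedge d false
    rw [Bool.not_false] at h1
    simp only [E, F, h, h1, if_true, Bool.false_eq_true, if_false]
    have hd := hcurve d
    have hd1 := hfibre d
    have hd2 := hfibre (M.rev d)
    clear two
    grind
  obtain ⟨g, hg1, hg2⟩ := hS.exists_coboundary hM (E := E)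
    (fun d => by
      rw [hE, M.rev_rev, ← Bool.not_true, ← hedge d true, Bool.not_true]
      ring)
    (fun d => by
      -- The corner from `x` to `M.face x` is one rotation, from `M.face x` to `M.rev x`, traversed
      -- backwards. Around the face the `F` terms cancel, leaving `hface` up to a cyclic shift.
      have hx : ∀ x, E x = e x true + r (M.face x) true + (F x true + F (M.face x) true) := by
        intro x
        have hr : M.rot (M.face x) = M.rev x := M.rot.apply_symm_apply _
        have := hF (M.face x) true
        rw [hr, Bool.not_true] at this
        rw [this]
        linear_combination -F (M.face x) true * two
      have h1 := sum_range_minimalPeriod_succ M.face (fun x => r x true) d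
      have h2 := sum_range_minimalPeriod_succ M.face (fun x => F x true) d
      have h0 := hface d
      simp only [sum_add_distrib] at h0
      simp only [hx, sum_add_distrib]
      rw [h1, h2, h0, CharTwo.add_self_eq_zero, add_zero])
  -- Since `g` is constant at vertices, adding it to both sheets leaves the rotations unchanged and
  -- corrects the edges by `E`.
  refine ⟨fun d ε => F d ε + g d, fun d ε => ?_, fun d ε => ?_⟩
  · linear_combination hF d ε - hg1 d - g d * two
  · have h1 := hg2 d
    cases ε
    · rw [hE] at h1
      rw [Bool.not_false]
      linear_combination h1 - (F d false + F (M.rev d) true) * two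
    · simp only [E] at h1
      rw [Bool.not_true]
      linear_combination h1 - (F d true + F (M.rev d) false) * two

theorem IsSphere.spinCocycle_iso [Finite D] {M : CombinatorialMap D} (hS : M.IsSphere)
    (hM : M.IsTrivalent) {s s' : M.branchedDoubleCover.SpinCocycle}
    (hface : ∀ x, s.onCurve (M.branchedDoubleCover.faceCurve x) =
      s'.onCurve (M.branchedDoubleCover.faceCurve x))
    (hcurve : ∀ d, s.onCurve (M.edgeCurve hM d) = s'.onCurve (M.edgeCurve hM d)) :
    s.Iso s' := by
  have two : (2 : ZMod 2) = 0 := CharTwo.two_eq_zero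
  obtain ⟨f, hr, he⟩ := hS.exists_coboundary_branchedDoubleCover hM
    (r := fun d ε => s'.onRot (d, ε) - s.onRot (d, ε))
    (e := fun d ε => s'.onEdge (d, ε) - s.onEdge (d, ε))
    (fun d => by
      have h := fibre_branchedDoubleCover hM s d true
      have h' := fibre_branchedDoubleCover hM s' d true
      rw [Bool.not_true] at h h'
      linear_combination h' - h)
    (fun d ε => by
      have h := s.edge (d, ε)
      have h' := s'.edge (d, ε)
      rw [branchedDoubleCover_rev] at h h'
      linear_combination h' - h +
        (s.onEdge (M.rev d, !ε) - s'.onEdge (M.rev d, !ε)) * two)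
    (fun d => by
      have h := hface (d, true)
      rw [onCurve_faceCurve_branchedDoubleCover, onCurve_faceCurve_branchedDoubleCover] at h
      simp only [sum_add_distrib, sum_sub_distrib] at h ⊢
      linear_combination -h)
    (fun d => by
      have h := hcurve d
      rw [onCurve_edgeCurve, onCurve_edgeCurve] at h
      linear_combination -h)
  refine ⟨fun x => f x.1 x.2, ?_, ?_⟩
  · rintro ⟨d, ε⟩
    rw [branchedDoubleCover_rot]
    linear_combination hr d ε
  · rintro ⟨d, ε⟩
    rw [branchedDoubleCover_rev]
    linear_combination he d ε

end CombinatorialMap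

open CombinatorialMap in
/-- Let `Γ` be a nonempty finite connected trivalent graph on the sphere. There is exactly one
`𝔭`-twisted spin structure on `Λ`, up to isomorphism, for which every `Ẽ` carries the Lie group
spin structure. -/
theorem mainTheorem6 {D : Type*} [Finite D] [Nonempty D] (Γ : CombinatorialMap D)
    (hsphere : Γ.IsSphere) (htri : Γ.IsTrivalent) :
    ∃! s : Γ.TwistedSpinStructure, ∀ d : D, s.1.IsLieGroupOn (Γ.edgeCurve htri d) := by
  refine ⟨⟨Quotient.mk _ (Γ.invariantCocycle htri), Γ.invariantCocycle_faceCurve htri⟩,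
    Γ.invariantCocycle_edgeCurve htri, ?_⟩
  rintro ⟨s, hs⟩ hcurve
  refine Subtype.ext ?_
  induction s using Quotient.inductionOn with | _ s
  refine Quotient.sound (hsphere.spinCocycle_iso htri (fun x => ?_) fun d => ?_)
  · exact (hs x).trans (Γ.invariantCocycle_faceCurve htri x).symm
  · exact (hcurve d).trans (Γ.invariantCocycle_edgeCurve htri d).symm
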